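/- Let $X$ be a completely regular Hausdorff (Tychonoff) space, let $C(X,\mathbb{C})$ be the ring of all continuous functions $X\to\mathbb{C}$, and let $C^*(X,\mathbb{C})$ be its subring of bounded functions. Let $\Sigma(X,\mathbb{C})$ be the family of all rings $P$ with $C^*(X,\mathbb{C})\subseteq P\subseteq C(X,\mathbb{C})$. Call $P\in\Sigma(X,\mathbb{C})$ a $C$-type ring if it is isomorphic, as a ring, to $C(Y,\mathbb{C})$ for some Tychonoff space $Y$. An ideal $I$ of a commutative ring $R$ with unity (possibly $I=R$) is called a $z$-ideal if for every $a\in I$ the intersection of all maximal ideals of $R$ containing $a$ is contained in $I$ (the empty intersection being $R$). (1) For every $z$-ideal $I$ of $C(X,\mathbb{C})$, the linear sum $C^*(X,\mathbb{C})+I=\{f+g: f\in C^*(X,\mathbb{C}),\ g\in I\}$ belongs to $\Sigma(X,\mathbb{C})$ and is a $C$-type ring. (2) Every $C$-type ring in $\Sigma(X,\mathbb{C})$ is of the form $C^*(X,\mathbb{C})+I$ for some $z$-ideal $I$ of $C(X,\mathbb{C})$ if and only if $X$ is pseudocompact, i.e. every continuous function $X\to\mathbb{R}$ is bounded. -/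

import Mathlib

universe u

/-- `C*(X,ℂ)`: the subring of `C(X,ℂ)` of bounded functions. -/
def boundedSubring (X : Type u) [TopologicalSpace X] : Subring C(X, ℂ) where
  carrier := {f | ∃ K : ℝ, ∀ x, ‖f x‖ ≤ K}
  mul_mem' := by
    rintro f g ⟨K, hK⟩ ⟨L, hL⟩
    refine ⟨K * L, fun x => ?_⟩
    rw [ContinuousMap.mul_apply, norm_mul]
    exact mul_le_mul (hK x) (hL x) (norm_nonneg _) ((norm_nonneg _).trans (hK x))
  one_mem' := ⟨1, fun x => by simp⟩
  add_mem' := by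
    rintro f g ⟨K, hK⟩ ⟨L, hL⟩
    exact ⟨K + L, fun x => (norm_add_le _ _).trans (add_le_add (hK x) (hL x))⟩
  zero_mem' := ⟨0, fun x => by simp⟩
  neg_mem' := by
    rintro f ⟨K, hK⟩
    exact ⟨K, fun x => by simpa using hK x⟩

/-- `Σ(X,ℂ)`: the family of all rings lying between `C*(X,ℂ)` and `C(X,ℂ)`. -/
def intermediateRings (X : Type u) [TopologicalSpace X] : Set (Subring C(X, ℂ)) :=
  {P | boundedSubring X ≤ P}

/-- An ideal `I` of a commutative ring is a `z`-ideal if, for each `a ∈ I`, the intersection of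
all maximal ideals containing `a` is contained in `I`. (The whole ring is a `z`-ideal.) -/
def IsZIdeal {R : Type u} [CommRing R] (I : Ideal R) : Prop :=
  ∀ a ∈ I, sInf {M : Ideal R | M.IsMaximal ∧ a ∈ M} ≤ I

/-- The linear sum `C*(X,ℂ) + I`, for an ideal `I` of `C(X,ℂ)`. -/
def boundedAddIdeal {X : Type u} [TopologicalSpace X] (I : Ideal C(X, ℂ)) :
    Subring C(X, ℂ) where
  carrier := {h | ∃ f ∈ boundedSubring X, ∃ g ∈ I, h = f + g}
  mul_mem' := by
    rintro _ _ ⟨f, hf, g, hg, rfl⟩ ⟨f', hf', g', hg', rfl⟩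
    refine ⟨f * f', mul_mem hf hf', f * g' + g * (f' + g'), ?_, by ring⟩
    exact add_mem (I.mul_mem_left _ hg') (I.mul_mem_right _ hg)
  one_mem' := ⟨1, one_mem _, 0, zero_mem _, by simp⟩
  add_mem' := by
    rintro _ _ ⟨f, hf, g, hg, rfl⟩ ⟨f', hf', g', hg', rfl⟩
    exact ⟨f + f', add_mem hf hf', g + g', add_mem hg hg', by ring⟩
  zero_mem' := ⟨0, zero_mem _, 0, zero_mem _, by simp⟩
  neg_mem' := by
    rintro _ ⟨f, hf, g, hg, rfl⟩
    exact ⟨-f, neg_mem hf, -g, neg_mem hg, by ring⟩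

/-- A ring of complex-valued continuous functions is a `C`-type ring if it is isomorphic, as a
ring, to `C(Y,ℂ)` for some Tychonoff (completely regular Hausdorff) space `Y`. -/
def IsCType {X : Type u} [TopologicalSpace X] (P : Subring C(X, ℂ)) : Prop :=
  ∃ (Y : Type u) (_ : TopologicalSpace Y) (_ : T35Space Y), Nonempty (P ≃+* C(Y, ℂ))

/-- `X` is pseudocompact if every real-valued continuous function on `X` is bounded. -/
def IsPseudocompact (X : Type u) [TopologicalSpace X] : Prop :=
  ∀ f : C(X, ℝ), ∃ K : ℝ, ∀ x, |f x| ≤ K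

/-! Everything reduces to rings of functions bounded along each filter of a family `𝓕`. Such a ring
is `C(Y)`, where `Y` is the set of points of `βX` at which the sphere-valued extension of every
member is finite (`isCType_boundedAlong`). For a `z`-ideal `I`, the sum `C* + I` is the case of one
filter, generated by the zero sets of members of `I`. If `X` is not pseudocompact, an increasing
sequence of principal filters gives a `C`-type ring not of this form; if it is, only `C(X)` lies in
`Σ(X)`. -/

open Filter Topology

/-- The ring of continuous functions that are bounded along each filter of a given family. -/
def boundedAlong {X : Type u} [TopologicalSpace X] (𝓕 : Set (Filter X)) :
    Subring C(X, ℂ) where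
  carrier := {f | ∀ F ∈ 𝓕, ∃ K : ℝ, ∀ᶠ x in F, ‖f x‖ ≤ K}
  mul_mem' := by
    intro f g hf hg F hF
    obtain ⟨K, hK⟩ := hf F hF
    obtain ⟨L, hL⟩ := hg F hF
    refine ⟨K * L, ?_⟩
    filter_upwards [hK, hL] with x h h'
    rw [ContinuousMap.mul_apply, norm_mul]
    exact mul_le_mul h h' (norm_nonneg _) ((norm_nonneg _).trans h)
  one_mem' := fun F _ => ⟨1, by simp⟩
  add_mem' := by
    intro f g hf hg F hF
    obtain ⟨K, hK⟩ := hf F hF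
    obtain ⟨L, hL⟩ := hg F hF
    refine ⟨K + L, ?_⟩
    filter_upwards [hK, hL] with x h h'
    exact (norm_add_le _ _).trans (add_le_add h h')
  zero_mem' := fun F _ => ⟨0, by simp⟩
  neg_mem' := by
    intro f hf F hF
    obtain ⟨K, hK⟩ := hf F hF
    exact ⟨K, by simpa using hK⟩

theorem mem_boundedAlong {X : Type u} [TopologicalSpace X] {𝓕 : Set (Filter X)} {f : C(X, ℂ)} :
    f ∈ boundedAlong 𝓕 ↔ ∀ F ∈ 𝓕, ∃ K : ℝ, ∀ᶠ x in F, ‖f x‖ ≤ K :=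
  Iff.rfl

theorem boundedSubring_le_boundedAlong {X : Type u} [TopologicalSpace X] (𝓕 : Set (Filter X)) :
    boundedSubring X ≤ boundedAlong 𝓕 := by
  rintro f ⟨K, hK⟩ F -
  exact ⟨K, Eventually.of_forall hK⟩

/-! ### Finite points in the Stone-Čech compactification -/

/-- The extension of a complex function to the Stone-Čech compactification, with values in the
Riemann sphere. -/
noncomputable def sphereExtend {X : Type u} [TopologicalSpace X] (f : C(X, ℂ)) :
    StoneCech X → OnePoint ℂ :=
  stoneCechExtend (OnePoint.continuous_coe.comp f.continuous)

theorem continuous_sphereExtend {X : Type u} [TopologicalSpace X] (f : C(X, ℂ)) :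
    Continuous (sphereExtend f) :=
  continuous_stoneCechExtend _

theorem sphereExtend_unit {X : Type u} [TopologicalSpace X] (f : C(X, ℂ)) (x : X) :
    sphereExtend f (stoneCechUnit x) = (f x : OnePoint ℂ) :=
  congrFun (stoneCechExtend_extends (OnePoint.continuous_coe.comp f.continuous)) x

/-- The points of the Stone-Čech compactification at which all members of a ring are finite. -/
def finitePoints {X : Type u} [TopologicalSpace X] (P : Subring C(X, ℂ)) : Set (StoneCech X) :=
  {p | ∀ f ∈ P, sphereExtend f p ≠ OnePoint.infty}

/-- The canonical map from a space to the points at which all members of a ring are finite. -/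
def toFinitePoints {X : Type u} [TopologicalSpace X] (P : Subring C(X, ℂ)) :
    C(X, finitePoints P) where
  toFun x := ⟨stoneCechUnit x, fun f _ => by
    rw [sphereExtend_unit]; exact OnePoint.coe_ne_infty _⟩
  continuous_toFun := continuous_stoneCechUnit.subtype_mk _

theorem denseRange_toFinitePoints {X : Type u} [TopologicalSpace X] (P : Subring C(X, ℂ)) :
    DenseRange (toFinitePoints P) := by
  intro p
  rw [closure_subtype, ← Set.range_comp]
  exact denseRange_stoneCechUnit p.1

theorem sphereExtend_eq_coe {X : Type u} [TopologicalSpace X] {P : Subring C(X, ℂ)}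
    (h : C(finitePoints P, ℂ)) (p : finitePoints P) :
    sphereExtend (h.comp (toFinitePoints P)) p = (h p : OnePoint ℂ) := by
  have key : (fun p : finitePoints P => sphereExtend (h.comp (toFinitePoints P)) p) =
      fun p => (h p : OnePoint ℂ) := (denseRange_toFinitePoints P).equalizer
    ((continuous_sphereExtend _).comp continuous_subtype_val)
    (OnePoint.continuous_coe.comp h.continuous) (funext fun x => sphereExtend_unit _ x)
  exact congrFun key p

theorem exists_comp_toFinitePoints {X : Type u} [TopologicalSpace X] {P : Subring C(X, ℂ)}
    {f : C(X, ℂ)} (hf : f ∈ P) :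
    ∃ h : C(finitePoints P, ℂ), h.comp (toFinitePoints P) = f := by
  choose h hh using fun p : finitePoints P => OnePoint.ne_infty_iff_exists.1 (p.2 f hf)
  refine ⟨⟨h, ?_⟩, ?_⟩
  · rw [OnePoint.isOpenEmbedding_coe.isEmbedding.continuous_iff]
    have : (fun z : ℂ => (z : OnePoint ℂ)) ∘ h = fun p : finitePoints P => sphereExtend f p :=
      funext hh
    rw [this]
    exact (continuous_sphereExtend f).comp continuous_subtype_val
  · ext x
    exact OnePoint.coe_injective ((hh (toFinitePoints P x)).trans (sphereExtend_unit f x))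

/-- Take an ultrafilter finer than some `F ∈ 𝓕` along which `‖f‖` tends to infinity, and let `p` be
its limit in `βX`. Members of the ring are bounded along `F`, hence finite at `p`. -/
theorem exists_sphereExtend_eq_infty {X : Type u} [TopologicalSpace X] {𝓕 : Set (Filter X)}
    {f : C(X, ℂ)} (hf : f ∉ boundedAlong 𝓕) :
    ∃ p ∈ finitePoints (boundedAlong 𝓕), sphereExtend f p = OnePoint.infty := by
  rw [mem_boundedAlong] at hf
  push Not at hf
  obtain ⟨F, hF, hunb⟩ := hf
  have hne : (F ⊓ comap (fun x => ‖f x‖) atTop).NeBot := by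
    refine inf_neBot_iff_frequently_right.2 fun {p} hp => ?_
    obtain ⟨K, -, hK⟩ := (atTop_basis_Ioi.comap _).eventually_iff.1 hp
    exact (hunb K).mono fun x hx => hK hx
  let U := Ultrafilter.of (F ⊓ comap (fun x => ‖f x‖) atTop)
  have hU : (U : Filter X) ≤ F ⊓ comap (fun x => ‖f x‖) atTop := Ultrafilter.of_le _
  obtain ⟨p, -, hp⟩ := isCompact_univ.ultrafilter_le_nhds (U.map stoneCechUnit) (by simp)
  have hlim (g : C(X, ℂ)) :
      Tendsto (fun x => (g x : OnePoint ℂ)) U (𝓝 (sphereExtend g p)) := by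
    have := ((continuous_sphereExtend g).tendsto p).comp
      (show Tendsto stoneCechUnit (U : Filter X) (𝓝 p) from hp)
    exact this.congr fun x => sphereExtend_unit g x
  refine ⟨p, fun g hg hinf => ?_, ?_⟩
  · obtain ⟨K, hK⟩ := hg F hF
    have h1 := hlim g
    rw [hinf] at h1
    have hc : IsCompact (Metric.closedBall (0 : ℂ) K) := isCompact_closedBall _ _
    have h2 := h1.eventually ((OnePoint.isOpen_compl_image_coe.2
      ⟨hc.isClosed, hc⟩).mem_nhds (OnePoint.infty_notMem_image_coe))
    obtain ⟨x, hx, hx'⟩ := (h2.and ((hU.trans inf_le_left) hK)).exists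
    exact hx ⟨g x, by simpa using hx', rfl⟩
  · refine tendsto_nhds_unique (hlim f) ?_
    have h1 : Tendsto (fun x => ‖f x‖) U atTop :=
      tendsto_iff_comap.2 (hU.trans inf_le_right)
    have h2 : Tendsto f U (cocompact ℂ) := by
      rwa [← Metric.cobounded_eq_cocompact, ← tendsto_norm_atTop_iff_cobounded]
    rw [← coclosedCompact_eq_cocompact] at h2
    exact OnePoint.tendsto_coe_infty.comp h2

/-- Restriction to `X` is injective by density. A restriction stays in the ring, since otherwise it
would be infinite at some point of `Y`. -/
theorem isCType_boundedAlong {X : Type u} [TopologicalSpace X] (𝓕 : Set (Filter X)) :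
    IsCType (boundedAlong 𝓕) := by
  let φ : C(finitePoints (boundedAlong 𝓕), ℂ) →+* C(X, ℂ) :=
    ContinuousMap.compRightAlgHom ℂ ℂ (toFinitePoints (boundedAlong 𝓕))
  have hφ (h) : φ h = h.comp (toFinitePoints (boundedAlong 𝓕)) := rfl
  have hmem (h) : φ h ∈ boundedAlong 𝓕 := by
    by_contra hn
    obtain ⟨p, hp, hinf⟩ := exists_sphereExtend_eq_infty hn
    rw [hφ, sphereExtend_eq_coe h ⟨p, hp⟩] at hinf
    exact OnePoint.coe_ne_infty _ hinf
  refine ⟨finitePoints (boundedAlong 𝓕), inferInstance, inferInstance,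
    ⟨(RingEquiv.ofBijective (φ.codRestrict _ hmem) ⟨fun h h' e => ?_, fun f => ?_⟩).symm⟩⟩
  · have e' : φ h = φ h' := congrArg Subtype.val e
    refine DFunLike.coe_injective ((denseRange_toFinitePoints (boundedAlong 𝓕)).equalizer
      h.continuous h'.continuous ?_)
    exact congrArg DFunLike.coe e'
  · obtain ⟨h, hh⟩ := exists_comp_toFinitePoints f.2
    exact ⟨h, Subtype.ext hh⟩

/-! ### `z`-ideals and zero sets -/

theorem star_mul_self_add_mem {X : Type u} [TopologicalSpace X] {I : Ideal C(X, ℂ)}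
    {f g : C(X, ℂ)} (hf : f ∈ I) (hg : g ∈ I) : star f * f + star g * g ∈ I :=
  add_mem (I.mul_mem_left _ hf) (I.mul_mem_left _ hg)

theorem star_mul_self_add_apply_eq_zero {X : Type u} [TopologicalSpace X] {f g : C(X, ℂ)}
    {x : X} : (star f * f + star g * g) x = 0 ↔ f x = 0 ∧ g x = 0 := by
  have : (star f * f + star g * g) x = ((‖f x‖ ^ 2 + ‖g x‖ ^ 2 : ℝ) : ℂ) := by
    simp [Complex.conj_mul']
  rw [this, Complex.ofReal_eq_zero, add_eq_zero_iff_of_nonneg (by positivity) (by positivity)]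
  simp

theorem Ideal.IsMaximal.mem_of_zeros_subset {X : Type u} [TopologicalSpace X]
    {M : Ideal C(X, ℂ)} (hM : M.IsMaximal) {g h : C(X, ℂ)} (hg : g ∈ M)
    (hgh : ∀ x, g x = 0 → h x = 0) : h ∈ M := by
  by_contra hn
  -- Since `r * h + m = 1`, the functions `g` and `m` have no common zero, so `|g|² + |m|²` is a
  -- unit in `M`.
  obtain ⟨r, m, hm, e⟩ := hM.exists_inv hn
  refine hM.ne_top (M.eq_top_of_isUnit_mem (star_mul_self_add_mem hg hm) ?_)
  rw [ContinuousMap.isUnit_iff_forall_ne_zero]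
  intro x hx
  obtain ⟨h1, h2⟩ := star_mul_self_add_apply_eq_zero.1 hx
  have := DFunLike.congr_fun e x
  simp [hgh x h1, h2] at this

theorem IsZIdeal.mem_of_zeros_subset {X : Type u} [TopologicalSpace X] {I : Ideal C(X, ℂ)}
    (hI : IsZIdeal I) {g h : C(X, ℂ)} (hg : g ∈ I) (hgh : ∀ x, g x = 0 → h x = 0) : h ∈ I :=
  hI g hg (Submodule.mem_sInf.2 fun _ hM => hM.1.mem_of_zeros_subset hM.2 hgh)

/-- The filter generated by the zero sets of the members of an ideal. -/
def zeroFilter {X : Type u} [TopologicalSpace X] (I : Ideal C(X, ℂ)) : Filter X where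
  sets := {A | ∃ g ∈ I, ∀ x, g x = 0 → x ∈ A}
  univ_sets := ⟨0, zero_mem _, fun _ _ => trivial⟩
  sets_of_superset := fun ⟨g, hg, h⟩ hAB => ⟨g, hg, fun x hx => hAB (h x hx)⟩
  inter_sets := by
    rintro A B ⟨f, hf, hA⟩ ⟨g, hg, hB⟩
    refine ⟨_, star_mul_self_add_mem hf hg, fun x hx => ?_⟩
    rw [star_mul_self_add_apply_eq_zero] at hx
    exact ⟨hA x hx.1, hB x hx.2⟩

theorem mem_boundedAlong_zeroFilter {X : Type u} [TopologicalSpace X] {I : Ideal C(X, ℂ)}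
    {h : C(X, ℂ)} : h ∈ boundedAlong {zeroFilter I} ↔
      ∃ K : ℝ, ∃ g ∈ I, ∀ x, g x = 0 → ‖h x‖ ≤ K := by
  simp only [mem_boundedAlong, Set.mem_singleton_iff, forall_eq]
  rfl

/-- Truncating `h` radially at a bound valid on the zero set of `g ∈ I` changes it only off that
set, so the difference lies in `I`. -/
theorem IsZIdeal.boundedAddIdeal_eq {X : Type u} [TopologicalSpace X] {I : Ideal C(X, ℂ)}
    (hI : IsZIdeal I) : boundedAddIdeal I = boundedAlong {zeroFilter I} := by
  ext h
  rw [mem_boundedAlong_zeroFilter]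
  constructor
  · rintro ⟨f, ⟨K, hK⟩, g, hg, rfl⟩
    exact ⟨K, g, hg, fun x hx => by simpa [hx] using hK x⟩
  · rintro ⟨K, g, hg, hK⟩
    -- The `1` keeps the denominator below positive.
    set L := max K 1
    have hL (x : X) : 0 < max L ‖h x‖ := by positivity
    let b : C(X, ℂ) := ⟨fun x => h x * ((L / max L ‖h x‖ : ℝ) : ℂ), by
      have : Continuous fun x => L / max L ‖h x‖ :=
        continuous_const.div (by fun_prop) fun x => (hL x).ne'
      fun_prop⟩
    have hb (x : X) : b x = h x * ((L / max L ‖h x‖ : ℝ) : ℂ) := rfl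
    refine ⟨b, ⟨L, fun x => ?_⟩, h - b, hI.mem_of_zeros_subset hg fun x hx => ?_, by ring⟩
    · have h0 : 0 ≤ L := by positivity
      rw [hb, norm_mul, Complex.norm_real, Real.norm_of_nonneg (div_nonneg h0 (hL x).le),
        mul_div_assoc', div_le_iff₀ (hL x), mul_comm]
      exact mul_le_mul_of_nonneg_left (le_max_right _ _) h0
    · have h1 : ‖h x‖ ≤ L := (hK x hx).trans (le_max_left _ _)
      have h2 : L ≠ 0 := by positivity
      rw [ContinuousMap.sub_apply, hb, max_eq_left h1, div_self h2]
      simp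

/-! ### The non-pseudocompact case -/

/-- A space with an unbounded continuous function has a continuous function `u` such that some
continuous function is unbounded on each of the level sets `u = k`. -/
theorem exists_unbounded_on_levels {X : Type u} [TopologicalSpace X]
    (hX : ¬ IsPseudocompact X) :
    ∃ f u : C(X, ℝ), ∀ k : ℕ, ∀ K : ℝ, ∃ x, u x = k ∧ K < f x := by
  simp only [IsPseudocompact, not_forall, not_exists, not_le] at hX
  obtain ⟨f₀, hf₀⟩ := hX
  let f : C(X, ℝ) := |f₀|
  have hf (K : ℝ) : ∃ x, K < f x := hf₀ K
  choose s hs using hf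
  let x : ℕ → X := fun n => Nat.rec (s 0) (fun _ y => s (f y + 1)) n
  have hx (n : ℕ) : f (x n) + 1 < f (x (n + 1)) := hs _
  have hmono : StrictMono fun n => f (x n) :=
    strictMono_nat_of_lt_succ fun n => by linarith [hx n]
  have hlt {m n : ℕ} (h : m < n) : f (x m) + 1 ≤ f (x n) :=
    (hx m).le.trans (hmono.monotone (Nat.succ_le_of_lt h))
  have hdist : Pairwise fun m n => (1 : ℝ) ≤ dist (f (x m)) (f (x n)) := by
    intro m n hmn
    rw [Real.dist_eq]
    rcases hmn.lt_or_gt with h | h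
    · exact le_abs.2 (Or.inr (by linarith [hlt h]))
    · exact le_abs.2 (Or.inl (by linarith [hlt h]))
  have hgrow (n : ℕ) : (n : ℝ) ≤ f (x n) := by
    induction n with
    | zero => simpa [x] using (hs 0).le
    | succ n ih => push_cast; linarith [hx n]
  have hemb : IsClosedEmbedding fun n => f (x n) :=
    Metric.isClosedEmbedding_of_pairwise_le_dist one_pos hdist
  -- The values `f (x n)` form a closed discrete set, so Tietze applies. Unpairing gives each level
  -- `k` the infinitely many indices `Nat.pair k N`.
  obtain ⟨φ, hφ⟩ := ContinuousMap.exists_extension' hemb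
    (⟨fun n : ℕ => ((Nat.unpair n).1 : ℝ), continuous_of_discreteTopology⟩ : C(ℕ, ℝ))
  refine ⟨f, φ.comp f, fun k K => ?_⟩
  obtain ⟨N, hN⟩ := exists_nat_gt K
  refine ⟨x (Nat.pair k N), ?_, ?_⟩
  · simpa using congrFun hφ (Nat.pair k N)
  · have : (N : ℝ) ≤ (Nat.pair k N : ℕ) := by exact_mod_cast Nat.right_le_pair k N
    linarith [hgrow (Nat.pair k N)]

/-- The function `u` is bounded on each `{|u| ≤ k}`. Were the ring `C* + I`, then `|u| ≤ K` on the
zero set of some `g ∈ I`, so anything vanishing where `u ≤ K` would be a member, even if unbounded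
on a level `u = k`. -/
theorem exists_isCType_ne_boundedAddIdeal {X : Type u} [TopologicalSpace X]
    (hX : ¬ IsPseudocompact X) :
    ∃ P ∈ intermediateRings X, IsCType P ∧
      ∀ I : Ideal C(X, ℂ), IsZIdeal I → P ≠ boundedAddIdeal I := by
  obtain ⟨f, u, hfu⟩ := exists_unbounded_on_levels hX
  let 𝓕 : Set (Filter X) := Set.range fun k : ℕ => 𝓟 {x | |u x| ≤ k}
  refine ⟨boundedAlong 𝓕, boundedSubring_le_boundedAlong 𝓕, isCType_boundedAlong 𝓕, ?_⟩
  intro I hI e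
  rw [hI.boundedAddIdeal_eq] at e
  have hu : (⟨fun x => (u x : ℂ), by fun_prop⟩ : C(X, ℂ)) ∈ boundedAlong 𝓕 := by
    rintro _ ⟨k, rfl⟩
    exact ⟨k, by simp⟩
  rw [e, mem_boundedAlong_zeroFilter] at hu
  obtain ⟨K, g, hg, hK⟩ := hu
  -- With `k ≥ K + 1` the cutoff in `w` equals `1` on `u = k`, so `w = f` there.
  obtain ⟨k, hk⟩ := exists_nat_ge (K + 1)
  let w : C(X, ℂ) := ⟨fun x => ((f x * min 1 (max 0 (u x - K)) : ℝ) : ℂ), by fun_prop⟩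
  have hw : w ∈ boundedAlong 𝓕 := by
    rw [e, mem_boundedAlong_zeroFilter]
    refine ⟨0, g, hg, fun x hx => ?_⟩
    have h1 : u x ≤ K := (le_abs_self _).trans (by simpa using hK x hx)
    have h2 : max 0 (u x - K) = 0 := max_eq_left (by linarith)
    simp [w, h2]
  obtain ⟨L, hL⟩ := hw _ ⟨k, rfl⟩
  obtain ⟨x, hx, hLx⟩ := hfu k L
  rw [eventually_principal] at hL
  have h1 := hL x (by simp [hx])
  have h2 : min 1 (max 0 (u x - K)) = 1 :=
    min_eq_left (le_max_of_le_right (by rw [hx]; linarith))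
  have h3 : w x = (f x : ℂ) := by
    change ((f x * min 1 (max 0 (u x - K)) : ℝ) : ℂ) = _
    rw [h2, mul_one]
  rw [h3, Complex.norm_real] at h1
  linarith [Real.le_norm_self (f x)]

theorem IsPseudocompact.boundedSubring_eq_top {X : Type u} [TopologicalSpace X]
    (hX : IsPseudocompact X) : boundedSubring X = ⊤ := by
  refine eq_top_iff.2 fun f _ => ?_
  obtain ⟨K, hK⟩ := hX ⟨fun x => ‖f x‖, by fun_prop⟩
  exact ⟨K, fun x => (le_abs_self _).trans (hK x)⟩

theorem mainTheorem8 {X : Type u} [TopologicalSpace X] [T35Space X] :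
    (∀ I : Ideal C(X, ℂ), IsZIdeal I →
      boundedAddIdeal I ∈ intermediateRings X ∧ IsCType (boundedAddIdeal I)) ∧
    ((∀ P ∈ intermediateRings X, IsCType P →
      ∃ I : Ideal C(X, ℂ), IsZIdeal I ∧ P = boundedAddIdeal I) ↔ IsPseudocompact X) := by
  refine ⟨fun I hI => ?_, fun h => ?_, fun hX P hP _ => ?_⟩
  · rw [hI.boundedAddIdeal_eq]
    exact ⟨boundedSubring_le_boundedAlong _, isCType_boundedAlong _⟩
  · by_contra hX
    obtain ⟨P, hP, hC, hne⟩ := exists_isCType_ne_boundedAddIdeal hX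
    obtain ⟨I, hI, e⟩ := h P hP hC
    exact hne I hI e
  · refine ⟨⊤, fun _ _ => le_top, ?_⟩
    have hP' : P = ⊤ := top_le_iff.1 (hX.boundedSubring_eq_top ▸ hP)
    rw [hP', eq_comm, eq_top_iff]
    exact fun f _ => ⟨0, zero_mem _, f, trivial, by simp⟩
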